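/- A group $\Gamma$ is \emph{LEF} if for every finite $F\subseteq\Gamma$ there are a finite group $Q$ and a local embedding of $F$ into $Q$, i.e. an injective map $\phi:F\to Q$ with $\phi(gh)=\phi(g)\phi(h)$ whenever $g,h,gh\in F$. If $\Gamma$ is an LEF group generated by a finite set $S$, let $B_S(n)$ be the set of elements of word length at most $n$ with respect to $S$, and let the \emph{LEF growth function} $\mathcal{L}_\Gamma^S(n)$ be the least order of a finite group into which $B_S(n)$ locally embeds. For nondecreasing functions $F_1,F_2$ on $\mathbb{N}$ write $F_1\preceq F_2$ if there is $C>0$ such that $F_1(n)\le F_2(Cn)$ for all $n$, and $F_1\approx F_2$ if $F_1\preceq F_2$ and $F_2\preceq F_1$. \textbf{Theorem.} There is an uncountable family $(\Gamma^{(r)})_{r\in[2,\infty)}$ of finitely generated LEF groups with the following properties. \begin{itemize} \item[(i)] For every $r\ge 2$ there is $C_r>0$ such that for every finite generating set $S$ of $\Gamma^{(r)}$, $\mathcal{L}_{\Gamma^{(r)}}^S(n)\preceq \exp\big(\exp(C_r(\log n)^r)\big)$. \item[(ii)] For every $r\ge 2$, all $2\le r'<r$, all $C>0$ and every finite generating set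 $S$ of $\Gamma^{(r)}$, $\mathcal{L}_{\Gamma^{(r)}}^S(n)\not\preceq \exp\big(\exp(C(\log n)^{r'})\big)$. \item[(iii)] For all distinct $r_1,r_2\ge 2$, the groups $\Gamma^{(r_1)}$ and $\Gamma^{(r_2)}$ are not isomorphic, and $\mathcal{L}_{\Gamma^{(r_1)}}^{S}\not\approx\mathcal{L}_{\Gamma^{(r_2)}}^{T}$ for all finite generating sets $S$ of $\Gamma^{(r_1)}$ and $T$ of $\Gamma^{(r_2)}$. \end{itemize} (At $n=0$ the comparison functions in (i) and (ii) are given their value at $n=1$.) -/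

import Mathlib

/-- `φ` restricts to a local embedding of `F ⊆ Γ` into `Δ`: it is injective on `F`, and
`φ (g * h) = φ g * φ h` whenever `g`, `h` and `g * h` all lie in `F`. Only the values of `φ` on `F`
matter. -/
def IsLocalEmbedding {Γ Δ : Type*} [Group Γ] [Group Δ] (F : Set Γ) (φ : Γ → Δ) : Prop :=
  Set.InjOn φ F ∧ ∀ g ∈ F, ∀ h ∈ F, g * h ∈ F → φ (g * h) = φ g * φ h

/-- `Γ` is locally embeddable into finite groups. -/
def IsLEF (Γ : Type*) [Group Γ] : Prop :=
  ∀ F : Set Γ, F.Finite →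
    ∃ (Q : Type) (_ : Group Q), Finite Q ∧ ∃ φ : Γ → Q, IsLocalEmbedding F φ

/-- The finite set `S` generates the group `Γ`. -/
def Generates {Γ : Type*} [Group Γ] (S : Finset Γ) : Prop :=
  Subgroup.closure (S : Set Γ) = ⊤

/-- The elements of `Γ` of word length at most `n` with respect to `S`: products of at most `n`
elements of `S ∪ S⁻¹`. -/
def wordBall {Γ : Type*} [Group Γ] (S : Finset Γ) (n : ℕ) : Set Γ :=
  {g | ∃ l : List Γ, l.length ≤ n ∧ (∀ s ∈ l, s ∈ S ∨ s⁻¹ ∈ S) ∧ l.prod = g}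

/-- The LEF growth function of `Γ` with respect to `S`: the least order of a finite group into which
the ball of radius `n` locally embeds. For `Γ` an LEF group the set below is nonempty. -/
noncomputable def lefGrowth {Γ : Type*} [Group Γ] (S : Finset Γ) (n : ℕ) : ℕ :=
  sInf {k | ∃ (Q : Type) (_ : Group Q), Finite Q ∧ Nat.card Q = k ∧
    ∃ φ : Γ → Q, IsLocalEmbedding (wordBall S n) φ}

/-- `F ≼ G`: there is a positive constant `C` with `F n ≤ G (C * n)` for all `n`. It is used for
nondecreasing functions only, so that taking `C` to be an integer is no restriction. -/
def GrowthLE {α : Type*} [LE α] (F G : ℕ → α) : Prop :=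
  ∃ C : ℕ, 0 < C ∧ ∀ n : ℕ, F n ≤ G (C * n)

/-- `F ≈ G`: `F ≼ G` and `G ≼ F`. -/
def GrowthEquiv {α : Type*} [LE α] (F G : ℕ → α) : Prop :=
  GrowthLE F G ∧ GrowthLE G F

/-- The function `n ↦ exp (exp (C * (log n) ^ r))`. At `n = 0`, where `Real.log 0 = 0`, it takes the
same value as at `n = 1`, so it is nondecreasing on `ℕ` for `C > 0` and `r > 0`. -/
noncomputable def expExpLogPow (C r : ℝ) (n : ℕ) : ℝ :=
  Real.exp (Real.exp (C * Real.log (n : ℝ) ^ r))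

/-! ### Word balls and local embeddings. -/

section WordBalls

variable {Γ Δ : Type*} [Group Γ] [Group Δ]

/-! The groups act on `ℤ × ℕ`, viewed as layers `{y} × ℕ`. They are generated by the shift of the
layers, an involution exchanging layers `0` and `-1`, and a twist acting on layer `p j` by
`blockSwap j`. The block swaps form an iterated wreath product of groups of order two, and `p`
controls how long a word must be to reach the `j`-th one.

Lower bound: the commutator `layerComm p j` has length at most `4 * p j + 4` and isolates `blockSwap
j`. Finitely many commutation relations among the first `k + 2` commutators, together with the
noncommutation of the first two, produce `2 ^ k` pairs `(a i, b i)` in which `a i` and `b j` commute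
exactly when `i ≠ j`. A chain of centralizers then gives any finite group containing them order at
least `2 ^ 2 ^ k` (`two_pow_two_pow_le_card`).

Upper bound: when the gaps before all positions from `p M` on exceed the reach of the words
considered, a word sees at most one twist beyond `p M`, and such a twist looks like the one at `p
M`. Closing the layers up periodically just after `p M` and truncating the fibres gives a finite
model with the same short relations (`prod_perm_eq_one_iff`), of order the factorial of about `p M *
2 ^ M`.

With `p j = 2 ^ ⌈j ^ (1 / r)⌉ * (j + 1)`, both the gaps and the positions have logarithm of order `j
^ (1 / r)`. Radius `n` therefore corresponds to an index of order `(log n) ^ r` in both bounds. -/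

theorem IsLocalEmbedding.mono {E F : Set Γ} {φ : Γ → Δ} (h : IsLocalEmbedding F φ) (hEF : E ⊆ F) :
    IsLocalEmbedding E φ :=
  ⟨h.1.mono hEF, fun g hg k hk hgk => h.2 g (hEF hg) k (hEF hk) (hEF hgk)⟩

theorem IsLocalEmbedding.map_one {F : Set Γ} {φ : Γ → Δ} (h : IsLocalEmbedding F φ)
    (h1 : (1 : Γ) ∈ F) : φ 1 = 1 := by
  have := h.2 1 h1 1 h1 (by simpa using h1)
  simpa using this

theorem one_mem_wordBall (S : Finset Γ) (n : ℕ) : (1 : Γ) ∈ wordBall S n :=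
  ⟨[], by simp, by simp, by simp⟩

theorem wordBall_mono (S : Finset Γ) {m n : ℕ} (h : m ≤ n) : wordBall S m ⊆ wordBall S n := by
  rintro g ⟨l, hl, hs, rfl⟩
  exact ⟨l, hl.trans h, hs, rfl⟩

theorem mem_wordBall_one {S : Finset Γ} {s : Γ} (h : s ∈ S) : s ∈ wordBall S 1 :=
  ⟨[s], by simp, by simpa using Or.inl h, by simp⟩

theorem mul_mem_wordBall {S : Finset Γ} {m n : ℕ} {g h : Γ} (hg : g ∈ wordBall S m)
    (hh : h ∈ wordBall S n) : g * h ∈ wordBall S (m + n) := by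
  obtain ⟨l, hl, hs, rfl⟩ := hg
  obtain ⟨l', hl', hs', rfl⟩ := hh
  refine ⟨l ++ l', by simp; omega, ?_, by simp⟩
  intro s hs1
  rcases List.mem_append.1 hs1 with h | h
  exacts [hs s h, hs' s h]

theorem inv_mem_wordBall {S : Finset Γ} {m : ℕ} {g : Γ} (hg : g ∈ wordBall S m) :
    g⁻¹ ∈ wordBall S m := by
  obtain ⟨l, hl, hs, rfl⟩ := hg
  refine ⟨(l.map (·⁻¹)).reverse, by simpa using hl, ?_, (List.prod_inv_reverse l).symm⟩
  intro s h
  have := hs s⁻¹ (by simpa using h)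
  rw [inv_inv] at this
  exact this.symm

theorem pow_mem_wordBall {S : Finset Γ} {s : Γ} (h : s ∈ wordBall S 1) (n : ℕ) :
    s ^ n ∈ wordBall S n := by
  induction n with
  | zero => simpa using one_mem_wordBall S 0
  | succ n ih => rw [pow_succ]; exact mul_mem_wordBall ih h

theorem exists_mem_wordBall {S : Finset Γ} (hS : Generates S) (g : Γ) : ∃ n, g ∈ wordBall S n := by
  have hg : g ∈ Subgroup.closure (S : Set Γ) := by rw [hS]; trivial
  induction hg using Subgroup.closure_induction with
  | mem x hx => exact ⟨1, mem_wordBall_one hx⟩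
  | one => exact ⟨0, one_mem_wordBall S 0⟩
  | mul x y _ _ hx hy =>
    obtain ⟨m, hm⟩ := hx
    obtain ⟨n, hn⟩ := hy
    exact ⟨m + n, mul_mem_wordBall hm hn⟩
  | inv x _ hx =>
    obtain ⟨m, hm⟩ := hx
    exact ⟨m, inv_mem_wordBall hm⟩

theorem Set.Finite.exists_subset_wordBall {S : Finset Γ} (hS : Generates S) {F : Set Γ}
    (hF : F.Finite) : ∃ n, F ⊆ wordBall S n := by
  choose N hN using exists_mem_wordBall hS
  obtain ⟨B, hB⟩ := (hF.image N).bddAbove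
  exact ⟨B, fun g hg => wordBall_mono S (hB (Set.mem_image_of_mem N hg)) (hN g)⟩

theorem exists_wordBall_subset_wordBall (S : Finset Γ) {T : Finset Γ} (hT : Generates T) :
    ∃ K : ℕ, 0 < K ∧ ∀ n, wordBall S n ⊆ wordBall T (K * n) := by
  obtain ⟨K, hK⟩ := Set.Finite.exists_subset_wordBall hT S.finite_toSet
  refine ⟨K + 1, K.succ_pos, fun n => ?_⟩
  rintro g ⟨l, hl, hs, rfl⟩
  refine wordBall_mono T (Nat.mul_le_mul_left _ hl) ?_
  clear hl
  induction l with
  | nil => exact one_mem_wordBall T _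
  | cons s l ih =>
    have h1 : s ∈ wordBall T (K + 1) := by
      apply wordBall_mono T K.le_succ
      rcases hs s (by simp) with h | h
      · exact hK h
      · simpa using inv_mem_wordBall (hK h)
    have := mul_mem_wordBall h1 (ih fun x hx => hs x (by simp [hx]))
    rw [List.prod_cons, List.length_cons]
    convert this using 2
    ring

theorem wordBall_zero (S : Finset Γ) : wordBall S 0 = {1} := by
  ext g
  constructor
  · rintro ⟨l, hl, -, rfl⟩
    simp [List.length_eq_zero_iff.1 (Nat.le_zero.1 hl)]
  · rintro rfl
    exact one_mem_wordBall S 0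

end WordBalls

/-! ### LEF growth: monotonicity, change of generators, isomorphism invariance. -/

section Growth

variable {Γ : Type*} [Group Γ]

theorem lefGrowth_le (S : Finset Γ) (n : ℕ) {Q : Type} [Group Q] [Finite Q] {φ : Γ → Q}
    (h : IsLocalEmbedding (wordBall S n) φ) : lefGrowth S n ≤ Nat.card Q :=
  Nat.sInf_le ⟨Q, inferInstance, inferInstance, rfl, φ, h⟩

theorem wordBall_finite (S : Finset Γ) (n : ℕ) : (wordBall S n).Finite := by
  classical
  induction n with
  | zero => rw [wordBall_zero]; exact Set.finite_singleton 1
  | succ n ih =>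
    have hfin : ((S : Set Γ) ∪ (S : Set Γ)⁻¹).Finite := S.finite_toSet.union S.finite_toSet.inv
    refine (ih.union ((hfin.prod ih).image fun x => x.1 * x.2)).subset ?_
    rintro g ⟨l, hl, hs, rfl⟩
    cases l with
    | nil => exact Or.inl (one_mem_wordBall S n)
    | cons s l =>
      refine Or.inr ⟨(s, l.prod), ⟨hs s (by simp), l, by simpa using hl, ?_, rfl⟩, by simp⟩
      exact fun x hx => hs x (by simp [hx])

/-- The infimum defining the LEF growth of an LEF group is attained. -/
theorem IsLEF.exists_card_eq_lefGrowth (hΓ : IsLEF Γ) (S : Finset Γ) (n : ℕ) :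
    ∃ (Q : Type) (_ : Group Q), Finite Q ∧ Nat.card Q = lefGrowth S n ∧
      ∃ φ : Γ → Q, IsLocalEmbedding (wordBall S n) φ := by
  have : lefGrowth S n ∈ {k | ∃ (Q : Type) (_ : Group Q), Finite Q ∧ Nat.card Q = k ∧
      ∃ φ : Γ → Q, IsLocalEmbedding (wordBall S n) φ} := by
    apply Nat.sInf_mem
    obtain ⟨Q, hQ, hfin, φ, hφ⟩ := hΓ _ (wordBall_finite S n)
    exact ⟨_, Q, hQ, hfin, rfl, φ, hφ⟩
  exact this

theorem IsLEF.lefGrowth_le_of_subset (hΓ : IsLEF Γ) {S T : Finset Γ} {m n : ℕ}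
    (h : wordBall S m ⊆ wordBall T n) : lefGrowth S m ≤ lefGrowth T n := by
  obtain ⟨Q, hQ, hfin, hcard, φ, hφ⟩ := hΓ.exists_card_eq_lefGrowth T n
  rw [← hcard]
  exact lefGrowth_le S m (hφ.mono h)

/-- Changing generators only rescales the radius, which `GrowthLE` absorbs. Bounds proved for one
generating set thus pass to all, with the same constant in the exponent. -/
theorem IsLEF.growthLE_lefGrowth (hΓ : IsLEF Γ) (S : Finset Γ) {T : Finset Γ} (hT : Generates T) :
    GrowthLE (lefGrowth S) (lefGrowth T) := by
  obtain ⟨K, hK, h⟩ := exists_wordBall_subset_wordBall S hT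
  exact ⟨K, hK, fun n => hΓ.lefGrowth_le_of_subset (h n)⟩

theorem lefGrowth_zero (S : Finset Γ) : lefGrowth S 0 ≤ 1 := by
  have h : IsLocalEmbedding (wordBall S 0) (fun _ => (1 : Multiplicative (Fin 1))) := by
    rw [wordBall_zero]
    exact ⟨Set.injOn_singleton _ _, fun _ _ _ _ _ => by simp⟩
  simpa using lefGrowth_le S 0 h

theorem GrowthLE.trans {α : Type*} [Preorder α] {F G H : ℕ → α} (h₁ : GrowthLE F G)
    (h₂ : GrowthLE G H) : GrowthLE F H := by
  obtain ⟨C, hC, h⟩ := h₁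
  obtain ⟨D, hD, h'⟩ := h₂
  refine ⟨D * C, Nat.mul_pos hD hC, fun n => (h n).trans ?_⟩
  rw [mul_assoc]
  exact h' _

theorem GrowthLE.natCast {F G : ℕ → ℕ} (h : GrowthLE F G) :
    GrowthLE (fun n => (F n : ℝ)) (fun n => (G n : ℝ)) := by
  obtain ⟨C, hC, h⟩ := h
  exact ⟨C, hC, fun n => Nat.cast_le.2 (h n)⟩

theorem Generates.map {Δ : Type*} [Group Δ] {S : Finset Γ} (hS : Generates S) (e : Γ ≃* Δ) :
    Generates (S.map e.toEquiv.toEmbedding) := by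
  unfold Generates at *
  have := congrArg (Subgroup.map e.toMonoidHom) hS
  rw [MonoidHom.map_closure, Subgroup.map_top_of_surjective _ e.surjective] at this
  simpa using this

theorem map_mem_wordBall {Δ : Type*} [Group Δ] {S : Finset Γ} (e : Γ ≃* Δ) {n : ℕ} {g : Γ}
    (hg : g ∈ wordBall S n) : e g ∈ wordBall (S.map e.toEquiv.toEmbedding) n := by
  obtain ⟨l, hl, hs, rfl⟩ := hg
  refine ⟨l.map e, by simpa using hl, ?_, (map_list_prod e l).symm⟩
  intro s h
  obtain ⟨x, hx, rfl⟩ := List.mem_map.1 h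
  rcases hs x hx with h | h
  · exact Or.inl (Finset.mem_map.2 ⟨x, h, rfl⟩)
  · exact Or.inr (Finset.mem_map.2 ⟨x⁻¹, h, map_inv e x⟩)

theorem IsLEF.lefGrowth_le_map {Δ : Type*} [Group Δ] (hΔ : IsLEF Δ) (e : Γ ≃* Δ) (S : Finset Γ)
    (n : ℕ) : lefGrowth S n ≤ lefGrowth (S.map e.toEquiv.toEmbedding) n := by
  obtain ⟨Q, hQ, hfin, hcard, φ, hφ⟩ :=
    hΔ.exists_card_eq_lefGrowth (S.map e.toEquiv.toEmbedding) n
  rw [← hcard]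
  refine lefGrowth_le S n (φ := φ ∘ e) ⟨?_, ?_⟩
  · exact fun x hx y hy hxy => e.injective
      (hφ.1 (map_mem_wordBall e hx) (map_mem_wordBall e hy) hxy)
  · intro g hg h hh hgh
    have := hφ.2 _ (map_mem_wordBall e hg) _ (map_mem_wordBall e hh)
      (by simpa using map_mem_wordBall e hgh)
    simpa using this

end Growth

/-! ### Local embeddings from shared short relations. -/

section Words

variable {Γ Q L : Type*} [Group Γ] [Group Q]

theorem prod_map_reverse_inv {ev : L → Γ} {inv : L → L} (h : ∀ a, ev (inv a) = (ev a)⁻¹)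
    (w : List L) : (((w.map inv).reverse).map ev).prod = ((w.map ev).prod)⁻¹ := by
  rw [List.prod_inv_reverse, List.map_reverse, List.map_map, List.map_map]
  congr 3
  funext a
  exact h a

/-- If the same words of length at most `3 * n` are trivial in `Γ` and in `Q`, then the ball of
radius `n` of `Γ` locally embeds into `Q`. -/
theorem exists_isLocalEmbedding_of_words [Nonempty L] (S : Finset Γ) (ev : L → Γ)
    (ev' : L → Q) (inv : L → L)
    (hinv : ∀ a, ev (inv a) = (ev a)⁻¹) (hinv' : ∀ a, ev' (inv a) = (ev' a)⁻¹)
    (hS : ∀ s, s ∈ S ∨ s⁻¹ ∈ S → ∃ a, ev a = s) (n : ℕ)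
    (hw : ∀ w : List L, w.length ≤ 3 * n → ((w.map ev).prod = 1 ↔ (w.map ev').prod = 1)) :
    ∃ φ : Γ → Q, IsLocalEmbedding (wordBall S n) φ := by
  classical
  have key : ∀ u v w : List L, u.length ≤ n → v.length ≤ n → w.length ≤ n →
      ((u.map ev).prod * (v.map ev).prod = (w.map ev).prod ↔
        (u.map ev').prod * (v.map ev').prod = (w.map ev').prod) := by
    intro u v w hu hv hw'
    -- The equation `u * v = w` is the triviality of `u * v * w⁻¹`, a word of length at most `3 *
    -- n`.
    have := hw (u ++ v ++ (w.map inv).reverse) (by simp; omega)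
    rw [List.map_append, List.map_append, List.map_append, List.map_append, List.prod_append,
      List.prod_append, List.prod_append, List.prod_append, prod_map_reverse_inv hinv,
      prod_map_reverse_inv hinv', mul_inv_eq_one, mul_inv_eq_one] at this
    exact this
  have hex : ∀ g : Γ, ∃ w : List L, g ∈ wordBall S n → w.length ≤ n ∧ (w.map ev).prod = g := by
    intro g
    by_cases hg : g ∈ wordBall S n
    · obtain ⟨l, hl, hs, rfl⟩ := hg
      choose! a ha using hS
      refine ⟨l.map a, fun _ => ⟨by simpa using hl, ?_⟩⟩
      rw [List.map_map]
      congr 1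
      conv_rhs => rw [← List.map_id l]
      exact List.map_congr_left fun s h => ha s (hs s h)
    · exact ⟨[], fun h => (hg h).elim⟩
  choose W hW using hex
  refine ⟨fun g => ((W g).map ev').prod, ?_, ?_⟩
  · intro g hg h hh hgh
    have := (key (W g) [] (W h) (hW g hg).1 (by simp) (hW h hh).1).2 (by simpa using hgh)
    rw [(hW g hg).2, (hW h hh).2] at this
    simpa using this
  · intro g hg h hh hgh
    have := (key (W g) (W h) (W (g * h)) (hW g hg).1 (hW h hh).1 (hW _ hgh).1).1
      (by rw [(hW g hg).2, (hW h hh).2, (hW _ hgh).2])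
    exact this.symm

end Words

/-! ### Commutation relations that force a large finite group. -/

section Forcing

variable {Q : Type*} [Group Q]

/-- Centralize the `b j` one after another: when `b i` is added, the centralizer loses `a i`, so its
order drops by a factor of at least two. -/
theorem two_pow_card_le_of_commute_iff [Finite Q] {ι : Type*} [Fintype ι] (a b : ι → Q)
    (hab : ∀ i j, Commute (a i) (b j) ↔ i ≠ j) : 2 ^ Fintype.card ι ≤ Nat.card Q := by
  classical
  suffices h : ∀ s : Finset ι,
      2 ^ s.card * Nat.card (Subgroup.centralizer (b '' (s : Set ι))) ≤ Nat.card Q by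
    have := h Finset.univ
    have hpos : 0 < Nat.card (Subgroup.centralizer (b '' ((Finset.univ : Finset ι) : Set ι))) :=
      Nat.card_pos
    exact (Nat.le_mul_of_pos_right _ hpos).trans this
  intro s
  induction s using Finset.induction_on with
  | empty => simpa using Subgroup.card_le_card_group _
  | insert i s hi ih =>
    set A := Subgroup.centralizer (b '' (s : Set ι))
    set B := Subgroup.centralizer (b '' ((insert i s : Finset ι) : Set ι))
    have hBA : B ≤ A := Subgroup.centralizer_le (Set.image_mono (by simp))
    have haA : a i ∈ A := by
      rw [Subgroup.mem_centralizer_iff]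
      rintro _ ⟨j, hj, rfl⟩
      exact ((hab i j).2 fun h => hi (h ▸ hj)).eq.symm
    have haB : a i ∉ B := by
      intro h
      rw [Subgroup.mem_centralizer_iff] at h
      exact (hab i i).1 (h (b i) ⟨i, by simp, rfl⟩).symm rfl
    obtain ⟨c, hc⟩ := Subgroup.card_dvd_of_le hBA
    have hlt : Nat.card B ≠ Nat.card A := by
      intro h
      exact haB ((Subgroup.eq_of_le_of_card_ge hBA h.ge) ▸ haA)
    have hApos : 0 < Nat.card A := Nat.card_pos
    have hc2 : 2 ≤ c := by
      rcases c with _ | _ | c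
      · omega
      · exact (hlt (by simpa using hc.symm)).elim
      · omega
    rw [Finset.card_insert_of_notMem hi]
    calc 2 ^ (s.card + 1) * Nat.card B = 2 ^ s.card * (Nat.card B * 2) := by ring
      _ ≤ 2 ^ s.card * (Nat.card B * c) := by gcongr
      _ = 2 ^ s.card * Nat.card A := by rw [hc]
      _ ≤ Nat.card Q := ih

theorem commute_conj_of_mem_closure {X : Set Q} {c : Q}
    (h : ∀ x ∈ X, ∀ y ∈ X, Commute x (c * y * c⁻¹)) {x y : Q} (hx : x ∈ Subgroup.closure X)
    (hy : y ∈ Subgroup.closure X) : Commute x (c * y * c⁻¹) := by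
  induction hx, hy using Subgroup.closure_induction₂ with
  | mem x y hx hy => exact h x hx y hy
  | one_left y _ => exact Commute.one_left _
  | one_right x _ => simp
  | mul_left x y z _ _ _ h1 h2 => exact h1.mul_left h2
  | mul_right x y z _ _ _ h1 h2 =>
    have := h1.mul_right h2
    simpa [mul_assoc] using this
  | inv_left x y _ _ h => exact h.inv_left
  | inv_right x y _ _ h =>
    have := h.inv_right
    simpa [mul_assoc] using this

/-- Doubling: the subgroup generated by the terms before `c = T (k + 2)` commutes elementwise with
its conjugate by `c`. Adjoining to a family in that subgroup its conjugate by `c` therefore keeps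
the commutation pattern and doubles the size. -/
theorem exists_commute_iff_family (T : ℕ → Q) (k : ℕ) (h01 : ¬ Commute (T 0) (T 1))
    (h : ∀ j < k + 2, ∀ i < j, ∀ i' < j, Commute (T i) (T j * T i' * (T j)⁻¹)) :
    ∃ (ι : Type) (_ : Fintype ι), Fintype.card ι = 2 ^ k ∧
      ∃ a b : ι → Q, (∀ i, a i ∈ Subgroup.closure (T '' Set.Iio (k + 2))) ∧
        (∀ i, b i ∈ Subgroup.closure (T '' Set.Iio (k + 2))) ∧
        ∀ i j, Commute (a i) (b j) ↔ i ≠ j := by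
  induction k with
  | zero =>
    refine ⟨Unit, inferInstance, by simp, fun _ => T 0, fun _ => T 1, ?_, ?_, ?_⟩
    · exact fun _ => Subgroup.subset_closure ⟨0, by simp, rfl⟩
    · exact fun _ => Subgroup.subset_closure ⟨1, by simp, rfl⟩
    · simpa using h01
  | succ k ih =>
    obtain ⟨ι, _, hcard, a, b, ha, hb, hab⟩ := ih fun j hj => h j (by omega)
    set c := T (k + 2)
    have hcomm : ∀ x ∈ Subgroup.closure (T '' Set.Iio (k + 2)),
        ∀ y ∈ Subgroup.closure (T '' Set.Iio (k + 2)), Commute x (c * y * c⁻¹) := by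
      intro x hx y hy
      refine commute_conj_of_mem_closure ?_ hx hy
      rintro _ ⟨i, hi, rfl⟩ _ ⟨i', hi', rfl⟩
      exact h (k + 2) (by omega) i hi i' hi'
    have hle : Subgroup.closure (T '' Set.Iio (k + 2)) ≤
        Subgroup.closure (T '' Set.Iio (k + 1 + 2)) :=
      Subgroup.closure_mono (Set.image_mono (Set.Iio_subset_Iio (by omega)))
    have hc : c ∈ Subgroup.closure (T '' Set.Iio (k + 1 + 2)) :=
      Subgroup.subset_closure ⟨k + 2, by simp, rfl⟩
    have hconj : ∀ x ∈ Subgroup.closure (T '' Set.Iio (k + 2)),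
        c * x * c⁻¹ ∈ Subgroup.closure (T '' Set.Iio (k + 1 + 2)) := fun x hx =>
      mul_mem (mul_mem hc (hle hx)) (inv_mem hc)
    refine ⟨ι ⊕ ι, inferInstance, by simp [hcard, pow_succ, mul_two],
      Sum.elim a fun i => c * a i * c⁻¹, Sum.elim b fun i => c * b i * c⁻¹, ?_, ?_, ?_⟩
    · rintro (i | i)
      exacts [hle (ha i), hconj _ (ha i)]
    · rintro (i | i)
      exacts [hle (hb i), hconj _ (hb i)]
    · rintro (i | i) (j | j)
      · simpa using hab i j
      · simpa using hcomm _ (ha i) _ (hb j)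
      · simpa using (hcomm _ (hb j) _ (ha i)).symm
      · simpa [Commute.conj_iff] using hab i j

theorem two_pow_two_pow_le_card [Finite Q] (T : ℕ → Q) (k : ℕ) (h01 : ¬ Commute (T 0) (T 1))
    (h : ∀ j < k + 2, ∀ i < j, ∀ i' < j, Commute (T i) (T j * T i' * (T j)⁻¹)) :
    2 ^ 2 ^ k ≤ Nat.card Q := by
  obtain ⟨ι, _, hcard, a, b, -, -, hab⟩ := exists_commute_iff_family T k h01 h
  rw [← hcard]
  exact two_pow_card_le_of_commute_iff a b hab

end Forcing

/-! ### The block swaps of `ℕ`. -/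

section BlockSwap

/-- The function exchanging `[0, 2 ^ j)` and `[2 ^ j, 2 ^ (j + 1))` by translation. -/
def blockSwapFun (j ω : ℕ) : ℕ :=
  if ω < 2 ^ j then ω + 2 ^ j else if ω < 2 ^ (j + 1) then ω - 2 ^ j else ω

theorem blockSwapFun_involutive (j : ℕ) : Function.Involutive (blockSwapFun j) := by
  intro ω
  unfold blockSwapFun
  rw [pow_succ]
  split_ifs <;> omega

/-- The involution of `ℕ` exchanging `[0, 2 ^ j)` and `[2 ^ j, 2 ^ (j + 1))` by translation. -/
def blockSwap (j : ℕ) : Equiv.Perm ℕ := (blockSwapFun_involutive j).toPerm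

theorem blockSwap_apply (j ω : ℕ) : blockSwap j ω =
    if ω < 2 ^ j then ω + 2 ^ j else if ω < 2 ^ (j + 1) then ω - 2 ^ j else ω := rfl

theorem blockSwap_blockSwap (j ω : ℕ) : blockSwap j (blockSwap j ω) = ω :=
  blockSwapFun_involutive j ω

theorem blockSwap_mul_self (j : ℕ) : blockSwap j * blockSwap j = 1 :=
  Equiv.ext fun ω => blockSwap_blockSwap j ω

theorem blockSwap_inv (j : ℕ) : (blockSwap j)⁻¹ = blockSwap j :=
  inv_eq_of_mul_eq_one_left (blockSwap_mul_self j)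

theorem blockSwap_of_le {j ω : ℕ} (h : 2 ^ (j + 1) ≤ ω) : blockSwap j ω = ω := by
  rw [blockSwap_apply]
  rw [pow_succ] at *
  split_ifs <;> omega

theorem blockSwap_lt_iff {i j ω : ℕ} (h : i ≤ j) :
    blockSwap i ω < 2 ^ (j + 1) ↔ ω < 2 ^ (j + 1) := by
  have h2 : 2 ^ (i + 1) ≤ 2 ^ (j + 1) := Nat.pow_le_pow_right (by norm_num) (by omega)
  rw [blockSwap_apply]
  rw [pow_succ 2 i] at *
  split_ifs <;> omega

/-- The supports are disjoint: the first lies in `[0, 2 ^ j)`, and conjugation by `blockSwap j`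
carries that of `blockSwap i'` out of this interval. -/
theorem blockSwap_commute_conj {i i' j : ℕ} (hi : i < j) (hi' : i' < j) :
    Commute (blockSwap i) (blockSwap j * blockSwap i' * (blockSwap j)⁻¹) := by
  apply Equiv.Perm.Disjoint.commute
  intro ω
  by_cases h : ω < 2 ^ j
  · right
    rw [blockSwap_inv, Equiv.Perm.mul_apply, Equiv.Perm.mul_apply]
    rw [blockSwap_of_le (j := i'), blockSwap_blockSwap]
    have h2 : 2 ^ (i' + 1) ≤ 2 ^ j := Nat.pow_le_pow_right (by norm_num) (by omega)
    rw [blockSwap_apply, if_pos h]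
    omega
  · left
    have h2 : 2 ^ (i + 1) ≤ 2 ^ j := Nat.pow_le_pow_right (by norm_num) (by omega)
    exact blockSwap_of_le (by omega)

theorem blockSwap_not_commute : ¬ Commute (blockSwap 0) (blockSwap 1) := by
  intro h
  have := congrArg (fun σ : Equiv.Perm ℕ => σ 0) h.eq
  simp [blockSwap_apply] at this

end BlockSwap

/-! ### Letters acting on layers, and comparison of local orbits. -/

section Layers

variable {A : Type*} [CommRing A] [DecidableEq A]

/-- The generators of the layered permutation groups, with the inverse of the shift. -/
inductive Letter
  | shift
  | unshift
  | twist
  | swap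

/-- The formal inverse of a letter. -/
def Letter.inv : Letter → Letter
  | .shift => .unshift
  | .unshift => .shift
  | .twist => .twist
  | .swap => .swap

/-- The permutation of `A × ℕ` given by a letter: the shift moves every layer `{y} × ℕ` to the next
one, the twist acts on the layer of `y` by `F y`, and the swap exchanges the layers of `0` and
`-1`. -/
def Letter.perm (F : A → Equiv.Perm ℕ) : Letter → Equiv.Perm (A × ℕ)
  | .shift => (Equiv.addRight 1).prodCongr (Equiv.refl ℕ)
  | .unshift => (Equiv.addRight (-1)).prodCongr (Equiv.refl ℕ)
  | .twist => Equiv.prodShear (Equiv.refl A) F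
  | .swap => (Equiv.swap 0 (-1)).prodCongr (Equiv.refl ℕ)

@[simp]
theorem Letter.perm_shift (F : A → Equiv.Perm ℕ) (y : A) (ω : ℕ) :
    Letter.shift.perm F (y, ω) = (y + 1, ω) := rfl

@[simp]
theorem Letter.perm_unshift (F : A → Equiv.Perm ℕ) (y : A) (ω : ℕ) :
    Letter.unshift.perm F (y, ω) = (y - 1, ω) := by
  simp [Letter.perm, sub_eq_add_neg]

@[simp]
theorem Letter.perm_twist (F : A → Equiv.Perm ℕ) (y : A) (ω : ℕ) :
    Letter.twist.perm F (y, ω) = (y, F y ω) := rfl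

@[simp]
theorem Letter.perm_swap (F : A → Equiv.Perm ℕ) (y : A) (ω : ℕ) :
    Letter.swap.perm F (y, ω) = (Equiv.swap 0 (-1) y, ω) := rfl

theorem Letter.perm_inv {F : A → Equiv.Perm ℕ} (hF : ∀ y, F y * F y = 1) (a : Letter) :
    a.inv.perm F = (a.perm F)⁻¹ := by
  rw [eq_inv_iff_mul_eq_one]
  ext1 ⟨y, ω⟩
  have h : F y (F y ω) = ω := by
    rw [← Equiv.Perm.mul_apply, hF, Equiv.Perm.one_apply]
  cases a <;> simp [Letter.inv, h]

/-- Two points whose neighbourhoods of radius `n` are matched by a translation of the layers and a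
map `θ` of the fibres are fixed by the same words of length at most `n`. -/
theorem prod_perm_fix_iff {F : ℤ → Equiv.Perm ℕ} {F' : A → Equiv.Perm ℕ} {n : ℕ} {y : ℤ} {y' : A}
    {E : Set ℕ} {θ : ℕ → ℕ} (hθ : E.InjOn θ)
    (hcast : ∀ d : ℤ, |d| ≤ n → (d : A) = 0 → d = 0)
    (hF : ∀ d : ℤ, |d| ≤ n → ∀ ω ∈ E, F (y + d) ω ∈ E ∧ θ (F (y + d) ω) = F' (y' + d) (θ ω))
    (h0 : ∀ d : ℤ, |d| ≤ n → (y + d = 0 ↔ y' + d = 0))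
    (h1 : ∀ d : ℤ, |d| ≤ n → (y + d = -1 ↔ y' + d = -1))
    {w : List Letter} (hw : w.length ≤ n) {ω : ℕ} (hω : ω ∈ E) :
    (w.map (Letter.perm F)).prod (y, ω) = (y, ω) ↔
      (w.map (Letter.perm F')).prod (y', θ ω) = (y', θ ω) := by
  -- Both orbits are followed letter by letter, keeping the same displacement `d` and fibre
  -- coordinates matched by `θ`.
  have key : ∃ d : ℤ, |d| ≤ w.length ∧ ∃ ω₁ ∈ E,
      (w.map (Letter.perm F)).prod (y, ω) = (y + d, ω₁) ∧
        (w.map (Letter.perm F')).prod (y', θ ω) = (y' + d, θ ω₁) := by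
    induction w with
    | nil => exact ⟨0, by simp, ω, hω, by simp, by simp⟩
    | cons a w ih =>
      rw [List.length_cons] at hw
      obtain ⟨d, hd, ω₁, hω₁, e, e'⟩ := ih (by omega)
      simp only [List.map_cons, List.prod_cons, Equiv.Perm.mul_apply, e, e', List.length_cons]
      have hdn : |d| ≤ n := by omega
      have hadd : |d + 1| ≤ (w.length : ℤ) + 1 := (abs_add_le d 1).trans (by simpa using hd)
      have hsub : |d - 1| ≤ (w.length : ℤ) + 1 := (abs_sub d 1).trans (by simpa using hd)
      cases a with
      | shift =>
        refine ⟨d + 1, hadd, ω₁, hω₁, ?_, ?_⟩ <;> simp [add_assoc]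
      | unshift =>
        refine ⟨d - 1, hsub, ω₁, hω₁, ?_, ?_⟩ <;> simp [add_sub_assoc]
      | twist =>
        obtain ⟨h2, h3⟩ := hF d hdn ω₁ hω₁
        exact ⟨d, by push_cast; omega, _, h2, by simp, by simp [h3]⟩
      | swap =>
        by_cases c0 : y + d = 0
        · have c0' := (h0 d hdn).1 c0
          refine ⟨d - 1, hsub, ω₁, hω₁, ?_, ?_⟩
          · simp [c0, ← add_sub_assoc]
          · simp [c0', ← add_sub_assoc]
        · have c0' := fun h => c0 ((h0 d hdn).2 h)
          by_cases c1 : y + d = -1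
          · have c1' := (h1 d hdn).1 c1
            refine ⟨d + 1, hadd, ω₁, hω₁, ?_, ?_⟩
            · simp [c1, ← add_assoc]
            · simp [c1', ← add_assoc]
          · have c1' := fun h => c1 ((h1 d hdn).2 h)
            refine ⟨d, by push_cast; omega, ω₁, hω₁, ?_, ?_⟩
            · simp [Equiv.swap_apply_of_ne_of_ne c0 c1]
            · simp [Equiv.swap_apply_of_ne_of_ne c0' c1']
  obtain ⟨d, hd, ω₁, hω₁, e, e'⟩ := key
  rw [e, e', Prod.mk.injEq, Prod.mk.injEq, add_eq_left, add_eq_left]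
  refine and_congr ⟨fun h => by simp [h], hcast d (by omega)⟩ ⟨fun h => by rw [h], ?_⟩
  exact fun h => hθ hω₁ hω h

end Layers

/-! ### The twist, its periodic version, and the region near the origin. -/

section LayerPerm

open Classical in
/-- The family of permutations of `ℕ` that is `blockSwap j` at `p j` and trivial elsewhere. -/
noncomputable def layerPerm (p : ℕ → ℕ) (y : ℤ) : Equiv.Perm ℕ :=
  if h : ∃ j, y = p j then blockSwap h.choose else 1

variable {p : ℕ → ℕ}

theorem layerPerm_apply_self (hp : StrictMono p) (j : ℕ) : layerPerm p (p j) = blockSwap j := by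
  have h : ∃ i, (p j : ℤ) = p i := ⟨j, rfl⟩
  rw [layerPerm, dif_pos h]
  congr 1
  have := h.choose_spec
  exact hp.injective (by exact_mod_cast this.symm)

theorem layerPerm_of_ne {y : ℤ} (h : ∀ j, y ≠ p j) : layerPerm p y = 1 :=
  dif_neg (by push Not; exact h)

theorem layerPerm_mul_self (p : ℕ → ℕ) (y : ℤ) : layerPerm p y * layerPerm p y = 1 := by
  unfold layerPerm
  split_ifs
  · exact blockSwap_mul_self _
  · simp

theorem layerPerm_lt_iff (hp : StrictMono p) {M : ℕ} {y : ℤ} (hy : y < p (M + 1)) (ω : ℕ) :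
    layerPerm p y ω < 2 ^ (M + 1) ↔ ω < 2 ^ (M + 1) := by
  by_cases h : ∃ j, y = p j
  · obtain ⟨j, rfl⟩ := h
    rw [layerPerm_apply_self hp]
    have : j < M + 1 := hp.lt_iff_lt.1 (by exact_mod_cast hy)
    exact blockSwap_lt_iff (by omega)
  · rw [layerPerm_of_ne (by simpa using h)]
    rfl

theorem layerPerm_of_le (hp : StrictMono p) {M : ℕ} {y : ℤ} (hy : y < p (M + 1)) {ω : ℕ}
    (hω : 2 ^ (M + 1) ≤ ω) : layerPerm p y ω = ω := by
  by_cases h : ∃ j, y = p j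
  · obtain ⟨j, rfl⟩ := h
    rw [layerPerm_apply_self hp]
    have : j < M + 1 := hp.lt_iff_lt.1 (by exact_mod_cast hy)
    exact blockSwap_of_le ((Nat.pow_le_pow_right (by norm_num) (by omega)).trans hω)
  · rw [layerPerm_of_ne (by simpa using h)]
    rfl

/-- The periodic family of permutations that agrees with `layerPerm p` on `[0, P)`. -/
noncomputable def periodicPerm (p : ℕ → ℕ) (P : ℕ) (y : ZMod P) : Equiv.Perm ℕ :=
  layerPerm p (y.val : ℤ)

theorem ZMod.intCast_eq_zero_of_abs_lt {P : ℕ} {d : ℤ} (hd : |d| < P) (h : (d : ZMod P) = 0) :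
    d = 0 := by
  rw [ZMod.intCast_zmod_eq_zero_iff_dvd] at h
  exact Int.eq_zero_of_abs_lt_dvd h hd

variable {N M : ℕ}

/-- The window is longer than a period. Its negative part wraps around to layers strictly between `p
M` and `p (M + 1)`, where there is no twist, just as at negative layers. -/
theorem periodicPerm_intCast (hp : StrictMono p)
    (hgap : ∀ i j, i < j → M ≤ j → p i + (2 * N + 3) ≤ p j) {y : ℤ} (h₁ : -(2 * N + 2) ≤ y)
    (h₂ : y ≤ p M + (2 * N + 2)) :
    periodicPerm p (p M + (2 * N + 3)) (y : ZMod (p M + (2 * N + 3))) = layerPerm p y := by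
  unfold periodicPerm
  rw [ZMod.val_intCast]
  push_cast
  rcases le_or_gt 0 y with hy | hy
  · rw [Int.emod_eq_of_lt hy (by omega)]
  · rw [← Int.add_emod_right, Int.emod_eq_of_lt (by omega) (by omega)]
    rw [layerPerm_of_ne, layerPerm_of_ne]
    · intro j; omega
    · intro j h
      rcases le_or_gt j M with hj | hj
      · have := hp.monotone hj
        omega
      · have := hgap M j hj hj.le
        omega

/-- A walk of length `N` stays below `p (M + 1)`, so only the block swaps up to `M` act, and these
fix every fibre point from `2 ^ (M + 1)` on. All those points can be collapsed to one. -/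
theorem prod_perm_fix_iff_near (hp : StrictMono p)
    (hgap : ∀ i j, i < j → M ≤ j → p i + (2 * N + 3) ≤ p j) {y : ℤ} (h₁ : -(N + 1) ≤ y)
    (h₂ : y ≤ p M + (N + 1)) (ω : ℕ) {w : List Letter} (hw : w.length ≤ N) :
    (w.map (Letter.perm (layerPerm p))).prod (y, ω) = (y, ω) ↔
      (w.map (Letter.perm (periodicPerm p (p M + (2 * N + 3))))).prod
        ((y : ZMod (p M + (2 * N + 3))), min ω (2 ^ (M + 1))) =
        ((y : ZMod (p M + (2 * N + 3))), min ω (2 ^ (M + 1))) := by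
  have hlt : ∀ d : ℤ, |d| ≤ N → y + d < p (M + 1) := by
    intro d hd
    have := hgap M (M + 1) (by omega) (by omega)
    have := abs_le.1 hd
    omega
  have hper : ∀ d : ℤ, |d| ≤ N → periodicPerm p (p M + (2 * N + 3))
      ((y : ZMod (p M + (2 * N + 3))) + (d : ZMod (p M + (2 * N + 3)))) =
        layerPerm p (y + d) := by
    intro d hd
    have := abs_le.1 hd
    rw [← Int.cast_add]
    exact periodicPerm_intCast hp hgap (by omega) (by omega)
  -- The set `E` is all of `[0, 2 ^ (M + 1))` if `ω` lies there, and `{ω}` otherwise; this makes the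
  -- truncation injective on it.
  refine prod_perm_fix_iff (θ := fun ω => min ω (2 ^ (M + 1)))
    (E := {z | z = ω ∨ z < 2 ^ (M + 1) ∧ ω < 2 ^ (M + 1)}) ?_ ?_ ?_ ?_ ?_ hw (Or.inl rfl)
  · intro a ha b hb hab
    simp only [Set.mem_ofPred_eq] at ha hb hab
    omega
  · exact fun d hd => ZMod.intCast_eq_zero_of_abs_lt (by push_cast; omega)
  · intro d hd z hz
    rw [hper d hd]
    simp only [Set.mem_ofPred_eq] at hz ⊢
    by_cases hzM : z < 2 ^ (M + 1)
    · have h3 := (layerPerm_lt_iff hp (hlt d hd) z).2 hzM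
      rw [min_eq_left hzM.le, min_eq_left h3.le]
      exact ⟨Or.inr ⟨h3, by omega⟩, rfl⟩
    · rw [layerPerm_of_le hp (hlt d hd) (by omega), min_eq_right (by omega),
        layerPerm_of_le hp (hlt d hd) le_rfl]
      exact ⟨hz, rfl⟩
  · intro d hd
    have := abs_le.1 hd
    rw [← Int.cast_add]
    refine ⟨fun h => by rw [h, Int.cast_zero], fun h => ?_⟩
    exact ZMod.intCast_eq_zero_of_abs_lt (abs_lt.2 ⟨by push_cast; omega, by push_cast; omega⟩) h
  · intro d hd
    have := abs_le.1 hd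
    rw [← Int.cast_add, ← add_eq_zero_iff_eq_neg, ← add_eq_zero_iff_eq_neg]
    refine ⟨fun h => ?_, fun h => ?_⟩
    · exact_mod_cast congrArg (Int.cast : ℤ → ZMod (p M + (2 * N + 3))) h
    · refine ZMod.intCast_eq_zero_of_abs_lt (P := p M + (2 * N + 3))
        (abs_lt.2 ⟨by push_cast; omega, by push_cast; omega⟩) (by push_cast at h ⊢; exact h)

end LayerPerm

/-! ### The finite model. -/

section FiniteModel

variable {p : ℕ → ℕ} {N M : ℕ}

theorem ZMod.intCast_ne_zero_of_pos_of_lt {P : ℕ} {v : ℤ} (h₁ : 0 < v) (h₂ : v < P) :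
    (v : ZMod P) ≠ 0 := fun h =>
  h₁.ne' (ZMod.intCast_eq_zero_of_abs_lt (by rwa [abs_of_pos h₁]) h)

theorem ZMod.intCast_ne_neg_one {P : ℕ} {v : ℤ} (h₁ : 0 < v) (h₂ : v + 1 < P) :
    (v : ZMod P) ≠ -1 := fun h =>
  ZMod.intCast_ne_zero_of_pos_of_lt (P := P) (v := v + 1) (by omega) h₂ (by push_cast; rw [h]; ring)

/-- A walk from such a layer never meets the layers `0` and `-1`, and by the gaps it meets at most
one twist. It can be imitated either where nothing acts or around `p M`. -/
theorem exists_prod_perm_fix_iff_far (hp : StrictMono p)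
    (hgap : ∀ i j, i < j → M ≤ j → p i + (2 * N + 3) ≤ p j) (hM : 2 * N + 3 ≤ p M) {y : ℤ}
    (hy : y < -(N + 1) ∨ p M + (N + 1) < y) (ω : ℕ) :
    ∃ (y' : ZMod (p M + (2 * N + 3))) (ω' : ℕ), ω' < 2 ^ (M + 1) + 1 ∧
      ∀ w : List Letter, w.length ≤ N →
        ((w.map (Letter.perm (layerPerm p))).prod (y, ω) = (y, ω) ↔
          (w.map (Letter.perm (periodicPerm p (p M + (2 * N + 3))))).prod (y', ω') = (y', ω')) := by
  set P := p M + (2 * N + 3) with hP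
  have hcast : ∀ d : ℤ, |d| ≤ N → (d : ZMod P) = 0 → d = 0 := fun d hd =>
    ZMod.intCast_eq_zero_of_abs_lt (by rw [hP]; push_cast; omega)
  by_cases htriv : ∀ d : ℤ, |d| ≤ N → layerPerm p (y + d) ω = ω
  -- The layers within `N` of this one lie strictly between `p M` and the end of the period, so no
  -- twist acts there.
  · refine ⟨((p M + (N + 1) : ℤ) : ZMod P), 2 ^ (M + 1), by omega, fun w hw => ?_⟩
    refine prod_perm_fix_iff (E := {ω}) (θ := fun _ => 2 ^ (M + 1)) (Set.injOn_singleton _ _) hcast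
      ?_ ?_ ?_ hw rfl
    · rintro d hd _ rfl
      have := abs_le.1 hd
      rw [← Int.cast_add, periodicPerm_intCast hp hgap (by omega) (by omega), htriv d hd]
      refine ⟨rfl, (layerPerm_of_le hp ?_ le_rfl).symm⟩
      have := hgap M (M + 1) (by omega) (by omega)
      omega
    · intro d hd
      have := abs_le.1 hd
      rw [← Int.cast_add]
      exact iff_of_false (by omega) (ZMod.intCast_ne_zero_of_pos_of_lt (by omega) (by omega))
    · intro d hd
      have := abs_le.1 hd
      rw [← Int.cast_add]
      exact iff_of_false (by omega) (ZMod.intCast_ne_neg_one (by omega) (by omega))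
  · push Not at htriv
    obtain ⟨e, he, hne⟩ := htriv
    have hen := abs_le.1 he
    obtain ⟨j, hj⟩ : ∃ j, y + e = p j := by
      by_contra! h
      exact hne (by rw [layerPerm_of_ne h]; rfl)
    have hMj : M < j := by
      refine hp.lt_iff_lt.1 ?_
      omega
    rw [hj, layerPerm_apply_self hp] at hne
    have hswap : blockSwap M 0 = 2 ^ M := by simp [blockSwap_apply]
    have hswap' : blockSwap M (2 ^ M) = 0 := by rw [← hswap, blockSwap_blockSwap]
    have h2 : 0 < 2 ^ M := by positivity
    -- The offset `e` now leads to `p M`, and the pair `{ω, blockSwap j ω}` is matched with `{0, 2 ^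
    -- M}`, which `blockSwap M` exchanges.
    refine ⟨((p M - e : ℤ) : ZMod P), 0, by omega, fun w hw => ?_⟩
    have := prod_perm_fix_iff (F := layerPerm p) (F' := periodicPerm p P) (n := N) (y := y)
      (y' := ((p M - e : ℤ) : ZMod P)) (E := {ω, blockSwap j ω})
      (θ := fun z => if z = ω then 0 else 2 ^ M) ?_ hcast ?_ ?_ ?_ hw (ω := ω) (by simp)
    · simpa using this
    · rintro a (rfl | rfl) b (rfl | rfl) hab
      · rfl
      · simp [hne] at hab
        omega
      · simp [hne] at hab
      · rfl
    · intro d hd z hz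
      have := abs_le.1 hd
      rw [← Int.cast_add, periodicPerm_intCast hp hgap (by omega) (by omega)]
      by_cases hde : d = e
      · rw [hde, hj, sub_add_cancel, layerPerm_apply_self hp, layerPerm_apply_self hp]
        rcases hz with rfl | rfl
        · simp [hne, hswap]
        · simp [hne, hswap', blockSwap_blockSwap]
      · rw [layerPerm_of_ne, layerPerm_of_ne]
        · exact ⟨hz, rfl⟩
        · intro i hi
          rcases lt_trichotomy i M with h | rfl | h
          · have := hgap i M h le_rfl
            omega
          · omega
          · have := hgap M i h h.le
            omega
        · intro i hi
          rcases lt_trichotomy i j with h | rfl | h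
          · have := hgap i j h hMj.le
            omega
          · omega
          · have := hgap j i h (by omega)
            omega
    · intro d hd
      have := abs_le.1 hd
      rw [← Int.cast_add]
      exact iff_of_false (by omega) (ZMod.intCast_ne_zero_of_pos_of_lt (by omega) (by omega))
    · intro d hd
      have := abs_le.1 hd
      rw [← Int.cast_add]
      exact iff_of_false (by omega) (ZMod.intCast_ne_neg_one (by omega) (by omega))

theorem prod_perm_eq_one_iff (hp : StrictMono p)
    (hgap : ∀ i j, i < j → M ≤ j → p i + (2 * N + 3) ≤ p j) (hM : 2 * N + 3 ≤ p M)
    {w : List Letter} (hw : w.length ≤ N) :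
    (w.map (Letter.perm (layerPerm p))).prod = 1 ↔
      ∀ (y' : ZMod (p M + (2 * N + 3))) (ω' : ℕ), ω' < 2 ^ (M + 1) + 1 →
        (w.map (Letter.perm (periodicPerm p (p M + (2 * N + 3))))).prod (y', ω') = (y', ω') := by
  constructor
  · intro h y' ω' hω'
    -- The near window contains exactly `p M + (2 * N + 3)` integers, one for each residue.
    obtain ⟨y, h₁, h₂, rfl⟩ : ∃ y : ℤ, -((N : ℤ) + 1) ≤ y ∧ y ≤ p M + ((N : ℤ) + 1) ∧
        (y : ZMod (p M + (2 * N + 3))) = y' := by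
      have hlt := ZMod.val_lt y'
      by_cases hv : y'.val ≤ p M + (N + 1)
      · exact ⟨y'.val, by omega, by omega, by simp⟩
      · refine ⟨y'.val - (p M + (2 * N + 3) : ℕ), by push_cast; omega, by push_cast; omega, ?_⟩
        rw [Int.cast_sub, Int.cast_natCast, Int.cast_natCast, ZMod.natCast_self]
        simp
    have := (prod_perm_fix_iff_near hp hgap h₁ h₂ ω' hw).1 (by rw [h]; rfl)
    rwa [min_eq_left (by omega)] at this
  · intro h
    ext1 ⟨y, ω⟩
    rw [Equiv.Perm.one_apply]
    by_cases hy : -((N : ℤ) + 1) ≤ y ∧ y ≤ p M + ((N : ℤ) + 1)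
    · exact (prod_perm_fix_iff_near hp hgap hy.1 hy.2 ω hw).2 (h _ _ (by omega))
    · obtain ⟨y', ω', hω', hiff⟩ := exists_prod_perm_fix_iff_far hp hgap hM (y := y) (by omega) ω
      exact (hiff w hw).2 (h y' ω' hω')

variable {A : Type*} [CommRing A] [DecidableEq A]

theorem Letter.perm_lt_iff {F : A → Equiv.Perm ℕ} {K : ℕ} (hF : ∀ y ω, F y ω < K ↔ ω < K)
    (a : Letter) (x : A × ℕ) : (a.perm F x).2 < K ↔ x.2 < K := by
  obtain ⟨y, ω⟩ := x
  cases a <;> simp [hF]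

/-- The restriction of `Letter.perm F` to the points with second coordinate less than `K`. -/
def Letter.permLT {F : A → Equiv.Perm ℕ} {K : ℕ} (hF : ∀ y ω, F y ω < K ↔ ω < K) (a : Letter) :
    Equiv.Perm {x : A × ℕ // x.2 < K} :=
  (a.perm F).subtypePerm (a.perm_lt_iff hF)

theorem coe_prod_permLT {F : A → Equiv.Perm ℕ} {K : ℕ} (hF : ∀ y ω, F y ω < K ↔ ω < K)
    (w : List Letter) (x : {x : A × ℕ // x.2 < K}) :
    ((w.map (Letter.permLT hF)).prod x : A × ℕ) = (w.map (Letter.perm F)).prod x := by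
  induction w with
  | nil => rfl
  | cons a w ih =>
    simp only [List.map_cons, List.prod_cons, Equiv.Perm.mul_apply]
    rw [← ih]
    rfl

theorem prod_permLT_eq_one_iff {F : A → Equiv.Perm ℕ} {K : ℕ} (hF : ∀ y ω, F y ω < K ↔ ω < K)
    (w : List Letter) : (w.map (Letter.permLT hF)).prod = 1 ↔
      ∀ y ω, ω < K → (w.map (Letter.perm F)).prod (y, ω) = (y, ω) := by
  constructor
  · intro h y ω hω
    have := coe_prod_permLT hF w ⟨(y, ω), hω⟩
    rw [h] at this
    exact this.symm
  · intro h
    ext1 ⟨⟨y, ω⟩, hω⟩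
    apply Subtype.ext
    rw [coe_prod_permLT]
    exact h y ω hω

theorem Letter.permLT_inv {F : A → Equiv.Perm ℕ} {K : ℕ} (hF : ∀ y ω, F y ω < K ↔ ω < K)
    (hF2 : ∀ y, F y * F y = 1) (a : Letter) : a.inv.permLT hF = (a.permLT hF)⁻¹ := by
  unfold Letter.permLT
  rw [Equiv.Perm.inv_subtypePerm]
  congr 1
  exact Letter.perm_inv hF2 a

theorem card_prod_lt (P K : ℕ) [NeZero P] : Nat.card {x : ZMod P × ℕ // x.2 < K} = P * K := by
  have e : {x : ZMod P × ℕ // x.2 < K} ≃ ZMod P × Fin K :=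
    { toFun := fun x => (x.1.1, ⟨x.1.2, x.2⟩)
      invFun := fun x => ⟨(x.1, x.2), x.2.2⟩
      left_inv := fun _ => rfl
      right_inv := fun _ => rfl }
  rw [Nat.card_congr e]
  simp

theorem finite_prod_lt (P K : ℕ) [NeZero P] : Finite {x : ZMod P × ℕ // x.2 < K} := by
  refine Finite.of_injective (β := ZMod P × Fin K) (fun x => (x.1.1, ⟨x.1.2, x.2⟩)) ?_
  rintro ⟨⟨a, b⟩, h⟩ ⟨⟨c, d⟩, h'⟩ e
  simpa using e

theorem periodicPerm_lt_iff (hp : StrictMono p)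
    (hgap : ∀ i j, i < j → M ≤ j → p i + (2 * N + 3) ≤ p j) (y : ZMod (p M + (2 * N + 3)))
    (ω : ℕ) : periodicPerm p (p M + (2 * N + 3)) y ω < 2 ^ (M + 1) + 1 ↔ ω < 2 ^ (M + 1) + 1 := by
  have h1 : ((y.val : ℕ) : ℤ) < p (M + 1) := by
    have := ZMod.val_lt y
    have := hgap M (M + 1) (by omega) (by omega)
    omega
  unfold periodicPerm
  by_cases h : ω < 2 ^ (M + 1)
  · have := (layerPerm_lt_iff hp h1 ω).2 h
    omega
  · rw [layerPerm_of_le hp h1 (by omega)]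

end FiniteModel

/-! ### The groups and their local embeddings into finite symmetric groups. -/

section LayerGroup

/-- The group of permutations of `ℤ × ℕ` generated by the shift, the twist and the swap. -/
def layerGroup (p : ℕ → ℕ) : Subgroup (Equiv.Perm (ℤ × ℕ)) :=
  Subgroup.closure (Set.range (Letter.perm (layerPerm p)))

/-- The generators of `layerGroup p`. -/
noncomputable def layerGen (p : ℕ → ℕ) (a : Letter) : layerGroup p :=
  ⟨a.perm (layerPerm p), Subgroup.subset_closure ⟨a, rfl⟩⟩

open Classical in
/-- The standard generating set of `layerGroup p`. -/
noncomputable def layerGens (p : ℕ → ℕ) : Finset (layerGroup p) :=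
  {layerGen p .shift, layerGen p .unshift, layerGen p .twist, layerGen p .swap}

theorem layerGen_mem (p : ℕ → ℕ) (a : Letter) : layerGen p a ∈ layerGens p := by
  cases a <;> simp [layerGens]

theorem exists_eq_layerGen {p : ℕ → ℕ} {s : layerGroup p} (hs : s ∈ layerGens p) :
    ∃ a, layerGen p a = s := by
  simp only [layerGens, Finset.mem_insert, Finset.mem_singleton] at hs
  rcases hs with rfl | rfl | rfl | rfl <;> exact ⟨_, rfl⟩

theorem layerGen_inv (p : ℕ → ℕ) (a : Letter) : layerGen p a.inv = (layerGen p a)⁻¹ :=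
  Subtype.ext (Letter.perm_inv (layerPerm_mul_self p) a)

theorem generates_layerGens (p : ℕ → ℕ) : Generates (layerGens p) := by
  have h : ((layerGens p : Finset _) : Set (layerGroup p)) =
      Subtype.val ⁻¹' Set.range (Letter.perm (layerPerm p)) := by
    ext s
    rw [Finset.mem_coe, Set.mem_preimage, Set.mem_range]
    constructor
    · intro hs
      obtain ⟨a, rfl⟩ := exists_eq_layerGen hs
      exact ⟨a, rfl⟩
    · rintro ⟨a, ha⟩
      rw [show s = layerGen p a from Subtype.ext ha.symm]
      exact layerGen_mem p a
  unfold Generates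
  rw [h]
  exact Subgroup.closure_closure_coe_preimage

theorem coe_prod_map_layerGen (p : ℕ → ℕ) (w : List Letter) :
    ((w.map (layerGen p)).prod : Equiv.Perm (ℤ × ℕ)) =
      (w.map (Letter.perm (layerPerm p))).prod := by
  rw [Subgroup.val_list_prod, List.map_map]
  rfl

theorem exists_isLocalEmbedding_layerGroup {p : ℕ → ℕ} (hp : StrictMono p) {n M : ℕ}
    (hgap : ∀ i j, i < j → M ≤ j → p i + (2 * (3 * n) + 3) ≤ p j)
    (hM : 2 * (3 * n) + 3 ≤ p M) :
    ∃ (Q : Type) (_ : Group Q), Finite Q ∧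
      Nat.card Q = ((p M + (2 * (3 * n) + 3)) * (2 ^ (M + 1) + 1)).factorial ∧
      ∃ φ : layerGroup p → Q, IsLocalEmbedding (wordBall (layerGens p) n) φ := by
  set P := p M + (2 * (3 * n) + 3) with hP
  set K := 2 ^ (M + 1) + 1
  have hF := periodicPerm_lt_iff hp hgap
  have : NeZero P := ⟨by omega⟩
  have := finite_prod_lt P K
  refine ⟨Equiv.Perm {x : ZMod P × ℕ // x.2 < K}, inferInstance, inferInstance, ?_, ?_⟩
  · rw [Nat.card_perm, card_prod_lt]
  · have : Nonempty Letter := ⟨.shift⟩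
    refine exists_isLocalEmbedding_of_words _ (layerGen p) (Letter.permLT hF) Letter.inv
      (layerGen_inv p) (Letter.permLT_inv hF fun y => layerPerm_mul_self p _) ?_ n ?_
    · rintro s (hs | hs)
      · exact exists_eq_layerGen hs
      · obtain ⟨a, ha⟩ := exists_eq_layerGen hs
        exact ⟨a.inv, by rw [layerGen_inv, ha, inv_inv]⟩
    · intro w hw
      rw [prod_permLT_eq_one_iff, ← prod_perm_eq_one_iff hp hgap hM hw, ← coe_prod_map_layerGen,
        OneMemClass.coe_eq_one]

end LayerGroup

/-! ### Short commutators and the lower bound. -/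

section LowerBound

variable {p : ℕ → ℕ}

theorem shift_pow_apply (F : ℤ → Equiv.Perm ℕ) (k : ℕ) (y : ℤ) (ω : ℕ) :
    (Letter.shift.perm F ^ k) (y, ω) = (y + k, ω) := by
  induction k generalizing y with
  | zero => simp
  | succ k ih =>
    rw [pow_succ, Equiv.Perm.mul_apply, Letter.perm_shift, ih]
    push_cast
    rw [add_assoc, add_comm 1]

theorem unshift_pow_apply (F : ℤ → Equiv.Perm ℕ) (k : ℕ) (y : ℤ) (ω : ℕ) :
    (Letter.unshift.perm F ^ k) (y, ω) = (y - k, ω) := by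
  induction k generalizing y with
  | zero => simp
  | succ k ih =>
    rw [pow_succ, Equiv.Perm.mul_apply, Letter.perm_unshift, ih]
    push_cast
    rw [sub_sub, add_comm 1]

/-- The conjugate of the twist by the `p i`-th power of the shift, times the swap. -/
noncomputable def twistSwap (p : ℕ → ℕ) (i : ℕ) : layerGroup p :=
  layerGen p .unshift ^ p i * layerGen p .twist * layerGen p .shift ^ p i * layerGen p .swap

/-- The commutator of a conjugate of the twist with the swap. It acts by `blockSwap i` on the layers
of `0` and `-1`. -/
noncomputable def layerComm (p : ℕ → ℕ) (i : ℕ) : layerGroup p :=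
  twistSwap p i * twistSwap p i

theorem coe_twistSwap_apply (p : ℕ → ℕ) (i : ℕ) (y : ℤ) (ω : ℕ) :
    (twistSwap p i : Equiv.Perm (ℤ × ℕ)) (y, ω) =
      (Equiv.swap 0 (-1) y, layerPerm p (Equiv.swap 0 (-1) y + p i) ω) := by
  have : (twistSwap p i : Equiv.Perm (ℤ × ℕ)) = Letter.unshift.perm (layerPerm p) ^ p i *
      Letter.twist.perm (layerPerm p) * Letter.shift.perm (layerPerm p) ^ p i *
      Letter.swap.perm (layerPerm p) := rfl
  rw [this]
  simp only [Equiv.Perm.mul_apply, Letter.perm_swap, shift_pow_apply, Letter.perm_twist,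
    unshift_pow_apply, add_sub_cancel_right]

/-- Off layers `0` and `-1` the shifted twist is squared, hence cancels. On these two layers its
values are multiplied; since positions are at least `2` apart, layer `p i - 1` is untwisted and only
`blockSwap i` remains. -/
theorem coe_layerComm_apply (hp : StrictMono p) (hsep : ∀ i j, i < j → p i + 2 ≤ p j) (i : ℕ)
    (y : ℤ) (ω : ℕ) : (layerComm p i : Equiv.Perm (ℤ × ℕ)) (y, ω) =
      (y, if y = 0 ∨ y = -1 then blockSwap i ω else ω) := by
  have h1 : layerPerm p (-1 + p i) = 1 := by
    refine layerPerm_of_ne fun j h => ?_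
    rcases lt_trichotomy i j with hij | rfl | hij
    · have := hsep i j hij
      omega
    · omega
    · have := hsep j i hij
      omega
  rw [layerComm, Subgroup.coe_mul, Equiv.Perm.mul_apply, coe_twistSwap_apply, coe_twistSwap_apply,
    Equiv.swap_apply_self]
  by_cases h0 : y = 0
  · simp [h0, h1, layerPerm_apply_self hp]
  by_cases h : y = -1
  · simp [h, h1, layerPerm_apply_self hp]
  rw [Equiv.swap_apply_of_ne_of_ne h0 h, ← Equiv.Perm.mul_apply, layerPerm_mul_self]
  simp [h0, h]

theorem layerComm_mul_self (hp : StrictMono p) (hsep : ∀ i j, i < j → p i + 2 ≤ p j) (i : ℕ) :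
    layerComm p i * layerComm p i = 1 := by
  apply Subtype.ext
  ext1 ⟨y, ω⟩
  rw [Subgroup.coe_mul, Equiv.Perm.mul_apply, coe_layerComm_apply hp hsep,
    coe_layerComm_apply hp hsep]
  split_ifs <;> simp [blockSwap_blockSwap]

theorem layerComm_commute_conj (hp : StrictMono p) (hsep : ∀ i j, i < j → p i + 2 ≤ p j)
    {i i' j : ℕ} (hi : i < j) (hi' : i' < j) :
    layerComm p i * (layerComm p j * layerComm p i' * layerComm p j) =
      layerComm p j * layerComm p i' * layerComm p j * layerComm p i := by
  apply Subtype.ext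
  ext1 ⟨y, ω⟩
  simp only [Subgroup.coe_mul, Equiv.Perm.mul_apply, coe_layerComm_apply hp hsep]
  split_ifs
  · have := congrArg (fun σ : Equiv.Perm ℕ => σ ω) (blockSwap_commute_conj hi hi').eq
    simp only [blockSwap_inv, Equiv.Perm.mul_apply] at this
    rw [this]
  · rfl

theorem layerComm_not_commute (hp : StrictMono p) (hsep : ∀ i j, i < j → p i + 2 ≤ p j) :
    layerComm p 0 * layerComm p 1 ≠ layerComm p 1 * layerComm p 0 := by
  intro h
  refine blockSwap_not_commute (Equiv.ext fun ω => ?_)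
  have := congrArg (fun σ : layerGroup p => (σ : Equiv.Perm (ℤ × ℕ)) (0, ω)) h
  simpa only [Subgroup.coe_mul, Equiv.Perm.mul_apply, coe_layerComm_apply hp hsep, true_or, if_true,
    Prod.mk.injEq, true_and] using this

theorem layerComm_mem_wordBall (p : ℕ → ℕ) (i : ℕ) :
    layerComm p i ∈ wordBall (layerGens p) (4 * p i + 4) := by
  have h : ∀ a, layerGen p a ∈ wordBall (layerGens p) 1 := fun a =>
    mem_wordBall_one (layerGen_mem p a)
  have h2 : twistSwap p i ∈ wordBall (layerGens p) (p i + 1 + p i + 1) :=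
    mul_mem_wordBall (mul_mem_wordBall (mul_mem_wordBall (pow_mem_wordBall (h _) _) (h _))
      (pow_mem_wordBall (h _) _)) (h _)
  exact wordBall_mono _ (by omega) (mul_mem_wordBall h2 h2)

/-- Each side of a required relation is a product of at most four commutators of length at most `4 *
p (k + 1) + 4`, so the ball of radius four times this sees all of them. -/
theorem two_pow_two_pow_le_card_of_isLocalEmbedding (hp : StrictMono p)
    (hsep : ∀ i j, i < j → p i + 2 ≤ p j) {Q : Type*} [Group Q] [Finite Q] (k : ℕ)
    {φ : layerGroup p → Q}
    (hφ : IsLocalEmbedding (wordBall (layerGens p) (16 * (p (k + 1) + 1))) φ) :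
    2 ^ 2 ^ k ≤ Nat.card Q := by
  set R := 4 * p (k + 1) + 4 with hR
  set B := wordBall (layerGens p) (16 * (p (k + 1) + 1))
  have hc : ∀ i < k + 2, layerComm p i ∈ wordBall (layerGens p) R := fun i hi => by
    have := hp.monotone (show i ≤ k + 1 by omega)
    exact wordBall_mono _ (by omega) (layerComm_mem_wordBall p i)
  have hB : ∀ m, m ≤ 4 * R → wordBall (layerGens p) m ⊆ B := fun m hm =>
    wordBall_mono _ (by omega)
  have hmul : ∀ {a b : ℕ} {g h : layerGroup p}, g ∈ wordBall (layerGens p) a →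
      h ∈ wordBall (layerGens p) b → a + b ≤ 4 * R → φ (g * h) = φ g * φ h := by
    intro a b g h hg hh hab
    exact hφ.2 g (hB a (by omega) hg) h (hB b (by omega) hh)
      (hB _ hab (mul_mem_wordBall hg hh))
  refine two_pow_two_pow_le_card (fun i => φ (layerComm p i)) k ?_ ?_
  · intro h
    have h0 := hc 0 (by omega)
    have h1 := hc 1 (by omega)
    refine layerComm_not_commute hp hsep (hφ.1 (hB (R + R) (by omega) (mul_mem_wordBall h0 h1))
      (hB (R + R) (by omega) (mul_mem_wordBall h1 h0)) ?_)
    rw [hmul h0 h1 (by omega), hmul h1 h0 (by omega)]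
    exact h
  · intro j hj i hi i' hi'
    have hj' := hc j hj
    have hi1 := hc i (by omega)
    have hi2 := hc i' (by omega)
    -- The commutators are involutions, so conjugation needs no inverses in the ball.
    have hinv : (φ (layerComm p j))⁻¹ = φ (layerComm p j) := by
      apply inv_eq_of_mul_eq_one_left
      rw [← hmul hj' hj' (by omega), layerComm_mul_self hp hsep]
      exact hφ.map_one (one_mem_wordBall _ _)
    have hconj := mul_mem_wordBall (mul_mem_wordBall hj' hi2) hj'
    have e := congrArg φ (layerComm_commute_conj hp hsep hi hi')
    rw [hmul hi1 hconj (by omega), hmul hconj hi1 (by omega),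
      hmul (mul_mem_wordBall hj' hi2) hj' (by omega), hmul hj' hi2 (by omega)] at e
    rw [hinv]
    exact e

end LowerBound

/-! ### The choice of positions and the upper bound. -/

section Positions

/-- The exponent `⌈j ^ (1 / r)⌉`. -/
noncomputable def posExp (r : ℝ) (j : ℕ) : ℕ := ⌈(j : ℝ) ^ (1 / r)⌉₊

/-- The position of the `j`-th block swap in the group with parameter `r`. -/
noncomputable def pos (r : ℝ) (j : ℕ) : ℕ := 2 ^ posExp r j * (j + 1)

variable {r : ℝ}

theorem posExp_mono (hr : 2 ≤ r) : Monotone (posExp r) := fun i j h =>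
  Nat.ceil_mono (Real.rpow_le_rpow (by positivity) (by exact_mod_cast h) (by positivity))

theorem posExp_le (hr : 2 ≤ r) (j : ℕ) : posExp r j ≤ j := by
  rcases Nat.eq_zero_or_pos j with rfl | hj
  · have : (1 / r) ≠ 0 := by positivity
    rw [posExp, Nat.cast_zero, Real.zero_rpow this, Nat.ceil_zero]
  · have h1 : (1 : ℝ) ≤ j := by exact_mod_cast hj
    refine Nat.ceil_le.2 ((Real.rpow_le_rpow_of_exponent_le h1 ?_).trans_eq (Real.rpow_one _))
    rw [div_le_one (by linarith)]
    linarith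

/-- The factor `j + 1` in `pos` is there for this: it separates positions even along the long runs
on which `posExp` is constant. -/
theorem pos_add_le_pos (hr : 2 ≤ r) {i j : ℕ} (h : i < j) :
    pos r i + 2 ^ posExp r j ≤ pos r j := by
  unfold pos
  calc 2 ^ posExp r i * (i + 1) + 2 ^ posExp r j
      ≤ 2 ^ posExp r j * (i + 1) + 2 ^ posExp r j := by
        gcongr
        · norm_num
        · exact posExp_mono hr h.le
    _ = 2 ^ posExp r j * (i + 2) := by ring
    _ ≤ 2 ^ posExp r j * (j + 1) := Nat.mul_le_mul_left _ (by omega)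

theorem pos_strictMono (hr : 2 ≤ r) : StrictMono (pos r) := fun i j h => by
  have := pos_add_le_pos hr h
  have : 0 < 2 ^ posExp r j := by positivity
  omega

theorem pos_add_two_le_pos (hr : 2 ≤ r) (i j : ℕ) (h : i < j) : pos r i + 2 ≤ pos r j := by
  have h1 := pos_add_le_pos hr h
  have h2 : 1 ≤ posExp r j := by
    have : (0 : ℝ) < j := by exact_mod_cast (by omega : 0 < j)
    exact Nat.one_le_iff_ne_zero.2 (Nat.ceil_pos.2 (Real.rpow_pos_of_pos this _)).ne'
  have h3 : 2 ^ 1 ≤ 2 ^ posExp r j := Nat.pow_le_pow_right (by norm_num) h2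
  omega

theorem factorial_le_exp_sq (D : ℕ) : (D.factorial : ℝ) ≤ Real.exp ((D : ℝ) ^ 2) := by
  calc (D.factorial : ℝ) ≤ (D : ℝ) ^ D := by exact_mod_cast Nat.factorial_le_pow D
    _ ≤ Real.exp (D : ℝ) ^ D := by
      gcongr
      linarith [Real.add_one_le_exp (D : ℝ)]
    _ = Real.exp ((D : ℝ) ^ 2) := by rw [← Real.exp_nat_mul, sq]

theorem exists_isLocalEmbedding_layerGroup_pos (hr : 2 ≤ r) {n M : ℕ}
    (hM : 2 * (3 * n) + 3 ≤ 2 ^ posExp r M) :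
    ∃ (Q : Type) (_ : Group Q), Finite Q ∧
      (Nat.card Q : ℝ) ≤ Real.exp (Real.exp (6 * (M + 1))) ∧
      ∃ φ : layerGroup (pos r) → Q, IsLocalEmbedding (wordBall (layerGens (pos r)) n) φ := by
  have hgap : ∀ i j, i < j → M ≤ j → pos r i + (2 * (3 * n) + 3) ≤ pos r j := by
    intro i j hij hj
    have h1 := pos_add_le_pos hr hij
    have h2 : 2 ^ posExp r M ≤ 2 ^ posExp r j :=
      Nat.pow_le_pow_right (by norm_num) (posExp_mono hr hj)
    omega
  have hMpos : 2 * (3 * n) + 3 ≤ pos r M := hM.trans (Nat.le_mul_of_pos_right _ (by omega))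
  obtain ⟨Q, hQ, hfin, hcard, hφ⟩ :=
    exists_isLocalEmbedding_layerGroup (pos_strictMono hr) hgap hMpos
  refine ⟨Q, hQ, hfin, ?_, hφ⟩
  rw [hcard]
  set D := (pos r M + (2 * (3 * n) + 3)) * (2 ^ (M + 1) + 1) with hD
  have hpow : 2 ^ posExp r M ≤ 2 ^ M := Nat.pow_le_pow_right (by norm_num) (posExp_le hr M)
  have hMle : M + 1 ≤ 2 ^ M := Nat.lt_two_pow_self
  have hpos : pos r M ≤ 2 ^ M * 2 ^ M := Nat.mul_le_mul hpow hMle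
  have h1 : 1 ≤ 2 ^ M := Nat.one_le_two_pow
  have hDle : D ≤ 2 ^ (3 * (M + 1)) := by
    calc D ≤ (2 ^ M * 2 ^ M + 2 ^ M * 2 ^ M) * (2 ^ (M + 1) + 2 ^ (M + 1)) := by
          refine Nat.mul_le_mul (Nat.add_le_add hpos ?_) ?_
          · exact (hM.trans hpow).trans (Nat.le_mul_of_pos_left _ h1)
          · exact Nat.add_le_add_left Nat.one_le_two_pow _
      _ = 2 ^ (3 * (M + 1)) := by ring
  refine (factorial_le_exp_sq D).trans (Real.exp_le_exp.2 ?_)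
  calc (D : ℝ) ^ 2 ≤ ((2 : ℝ) ^ (3 * (M + 1))) ^ 2 := by
        gcongr
        exact_mod_cast hDle
    _ = 2 ^ (6 * (M + 1)) := by rw [← pow_mul]; ring_nf
    _ ≤ Real.exp 1 ^ (6 * (M + 1)) := by
        gcongr
        linarith [Real.add_one_le_exp (1 : ℝ)]
    _ = Real.exp (6 * (M + 1)) := by
        rw [← Real.exp_nat_mul]
        push_cast
        rw [mul_one]

/-- Take `M` to be the ceiling of `(log₂ a) ^ r`, which inverts `posExp`. -/
theorem exists_le_two_pow_posExp (hr : 2 ≤ r) (a : ℕ) (ha : 1 ≤ a) :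
    ∃ M : ℕ, a ≤ 2 ^ posExp r M ∧ (M : ℝ) ≤ Real.logb 2 a ^ r + 1 := by
  have hlog : 0 ≤ Real.logb 2 a := Real.logb_nonneg (by norm_num) (by exact_mod_cast ha)
  have hr0 : r ≠ 0 := by positivity
  refine ⟨⌈Real.logb 2 a ^ r⌉₊, ?_, (Nat.ceil_lt_add_one (by positivity)).le⟩
  have h1 : Real.logb 2 a ≤ posExp r ⌈Real.logb 2 a ^ r⌉₊ := by
    calc Real.logb 2 a = (Real.logb 2 a ^ r) ^ (1 / r) := by
          rw [← Real.rpow_mul hlog, mul_one_div_cancel hr0, Real.rpow_one]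
      _ ≤ (⌈Real.logb 2 a ^ r⌉₊ : ℝ) ^ (1 / r) := by
          gcongr
          exact Nat.le_ceil _
      _ ≤ _ := Nat.le_ceil _
  have h2 : (a : ℝ) ≤ 2 ^ posExp r ⌈Real.logb 2 a ^ r⌉₊ := by
    rw [Real.logb_le_iff_le_rpow (by norm_num) (by positivity), Real.rpow_natCast] at h1
    exact h1
  exact_mod_cast h2

theorem isLEF_layerGroup_pos (hr : 2 ≤ r) : IsLEF (layerGroup (pos r)) := by
  intro F hF
  obtain ⟨n, hn⟩ := Set.Finite.exists_subset_wordBall (generates_layerGens (pos r)) hF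
  obtain ⟨M, hM, -⟩ := exists_le_two_pow_posExp hr (2 * (3 * n) + 3) (by omega)
  obtain ⟨Q, hQ, hfin, -, φ, hφ⟩ := exists_isLocalEmbedding_layerGroup_pos hr hM
  exact ⟨Q, hQ, hfin, φ, hφ.mono hn⟩

theorem fg_layerGroup (p : ℕ → ℕ) : Group.FG (layerGroup p) :=
  ⟨⟨layerGens p, generates_layerGens p⟩⟩

theorem growthLE_expExpLogPow (hr : 2 ≤ r) :
    GrowthLE (fun n => (lefGrowth (layerGens (pos r)) n : ℝ))
      (expExpLogPow (6 * 2 ^ r + 12) r) := by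
  -- For `n ≥ 1`, `6 * n + 3 ≤ 9 * n` and `log (9 * n) ≥ 1`, so additive constants are absorbed by
  -- `Λ ^ r`.
  refine ⟨9, by norm_num, fun n => ?_⟩
  have hr0 : r ≠ 0 := by positivity
  rcases Nat.eq_zero_or_pos n with rfl | hn
  · have h1 : (lefGrowth (layerGens (pos r)) 0 : ℝ) ≤ 1 := by exact_mod_cast lefGrowth_zero _
    exact h1.trans (Real.one_le_exp (Real.exp_pos _).le)
  obtain ⟨M, hM, hMle⟩ := exists_le_two_pow_posExp hr (2 * (3 * n) + 3) (by omega)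
  obtain ⟨Q, hQ, hfin, hcard, φ, hφ⟩ := exists_isLocalEmbedding_layerGroup_pos hr hM
  have hle : (lefGrowth (layerGens (pos r)) n : ℝ) ≤ Nat.card Q := by
    exact_mod_cast lefGrowth_le _ n hφ
  refine (hle.trans hcard).trans (Real.exp_le_exp.2 (Real.exp_le_exp.2 ?_))
  have hn1 : (1 : ℝ) ≤ n := by exact_mod_cast hn
  set Λ := Real.log ((9 * n : ℕ) : ℝ) with hΛ
  have hΛ1 : 1 ≤ Λ := by
    rw [hΛ, Real.le_log_iff_exp_le (by positivity)]
    push_cast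
    linarith [Real.exp_one_lt_d9]
  have hlog : Real.logb 2 ((2 * (3 * n) + 3 : ℕ) : ℝ) ≤ 2 * Λ := by
    rw [Real.logb, div_le_iff₀ (Real.log_pos (by norm_num))]
    have h1 : Real.log ((2 * (3 * n) + 3 : ℕ) : ℝ) ≤ Λ :=
      Real.log_le_log (by positivity) (by exact_mod_cast (by omega))
    nlinarith [Real.log_two_gt_d9]
  have hlog0 : 0 ≤ Real.logb 2 ((2 * (3 * n) + 3 : ℕ) : ℝ) :=
    Real.logb_nonneg (by norm_num) (by exact_mod_cast (by omega))
  have h2 : Real.logb 2 ((2 * (3 * n) + 3 : ℕ) : ℝ) ^ r ≤ 2 ^ r * Λ ^ r := by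
    rw [← Real.mul_rpow (by norm_num) (by linarith)]
    exact Real.rpow_le_rpow hlog0 hlog (by linarith)
  have h3 : 1 ≤ Λ ^ r := Real.one_le_rpow hΛ1 (by linarith)
  linarith

/-- With `x = k ^ (1 / r)`, the power of two contributes at most `x + 1`, and the factor `k + 1` at
most `1 + r * log x ≤ 1 + r * x`. -/
theorem log_pos_le (hr : 2 ≤ r) {k : ℕ} (hk : 1 ≤ k) :
    Real.log (pos r k) ≤ (3 + r) * (k : ℝ) ^ (1 / r) := by
  have hk1 : (1 : ℝ) ≤ k := by exact_mod_cast hk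
  have hr0 : r ≠ 0 := by positivity
  set x := (k : ℝ) ^ (1 / r) with hx
  have hx1 : 1 ≤ x := Real.one_le_rpow hk1 (by positivity)
  have hkx : Real.log k = r * Real.log x := by
    rw [hx, Real.log_rpow (by linarith)]
    field_simp
  have hlogx : Real.log x ≤ x := (Real.log_le_sub_one_of_pos (by linarith)).trans (by linarith)
  have hlog2 : Real.log 2 ≤ 1 := by linarith [Real.log_two_lt_d9]
  have hlog20 : 0 ≤ Real.log 2 := by linarith [Real.log_two_gt_d9]
  have he : (posExp r k : ℝ) ≤ x + 1 := (Nat.ceil_lt_add_one (by linarith)).le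
  have h1 : Real.log ((k : ℝ) + 1) ≤ Real.log 2 + Real.log k := by
    rw [← Real.log_mul (by norm_num) (by linarith)]
    exact Real.log_le_log (by linarith) (by linarith)
  have h2 : Real.log (pos r k) = posExp r k * Real.log 2 + Real.log ((k : ℝ) + 1) := by
    unfold pos
    push_cast
    rw [Real.log_mul (by positivity) (by positivity), Real.log_pow]
  have h3 : (posExp r k : ℝ) * Real.log 2 ≤ (x + 1) * 1 := by gcongr
  have h4 : r * Real.log x ≤ r * x := by gcongr
  rw [h2]
  linarith

end Positions

/-! ### Separation of the growth types, and the theorem. -/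

theorem not_growthLE_expExpLogPow {r r' C : ℝ} (hr : 2 ≤ r) (hr' : 2 ≤ r')
    (hlt : r' < r) (hC : 0 < C) :
    ¬ GrowthLE (fun n => (lefGrowth (layerGens (pos r)) n : ℝ)) (expExpLogPow C r') := by
  rintro ⟨K, hK, h⟩
  have hlower : ∀ k : ℕ, (2 : ℝ) ^ 2 ^ k ≤
      lefGrowth (layerGens (pos r)) (16 * (pos r (k + 1) + 1)) := by
    intro k
    obtain ⟨Q, hQ, hfin, hcard, φ, hφ⟩ := (isLEF_layerGroup_pos hr).exists_card_eq_lefGrowth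
      (layerGens (pos r)) (16 * (pos r (k + 1) + 1))
    rw [← hcard]
    exact_mod_cast two_pow_two_pow_le_card_of_isLocalEmbedding (pos_strictMono hr)
      (pos_add_two_le_pos hr) k hφ
  set B : ℝ := Real.log (32 * K) + (3 + r) with hB
  have hK1 : (1 : ℝ) ≤ K := by exact_mod_cast hK
  have hlogK : 0 ≤ Real.log (32 * K) := Real.log_nonneg (by linarith)
  have hB0 : 0 < B := by linarith
  -- Two logarithms turn the assumed bound into a linear function of `k` bounded by a multiple of
  -- `(k + 1) ^ (r' / r)`, which is sublinear.
  have hmain : ∀ k : ℕ, ((k : ℝ) + 1) / 2 - 2 ≤ C * B ^ r' * ((k : ℝ) + 1) ^ (r' / r) := by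
    intro k
    have hp1 : 1 ≤ pos r (k + 1) := Nat.mul_pos (by positivity) (by omega)
    have hp1' : (1 : ℝ) ≤ pos r (k + 1) := by exact_mod_cast hp1
    have h1 := (hlower k).trans (h (16 * (pos r (k + 1) + 1)))
    set x := ((k : ℝ) + 1) ^ (1 / r) with hx
    have hx1 : 1 ≤ x := Real.one_le_rpow (by linarith [k.cast_nonneg (α := ℝ)]) (by positivity)
    have hlog : Real.log ((K * (16 * (pos r (k + 1) + 1)) : ℕ) : ℝ) ≤ B * x := by
      have h2 : Real.log ((K * (16 * (pos r (k + 1) + 1)) : ℕ) : ℝ) ≤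
          Real.log (32 * K) + Real.log (pos r (k + 1)) := by
        rw [← Real.log_mul (by positivity) (by positivity)]
        refine Real.log_le_log (by positivity) ?_
        push_cast
        nlinarith
      have h3 := log_pos_le hr (k := k + 1) (by omega)
      push_cast at h3
      have h4 : Real.log (32 * K) * 1 ≤ Real.log (32 * K) * x := by gcongr
      rw [hB, add_mul]
      linarith
    have hlog0 : 0 ≤ Real.log ((K * (16 * (pos r (k + 1) + 1)) : ℕ) : ℝ) :=
      Real.log_natCast_nonneg _
    have h5 : Real.log ((K * (16 * (pos r (k + 1) + 1)) : ℕ) : ℝ) ^ r' ≤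
        B ^ r' * ((k : ℝ) + 1) ^ (r' / r) := by
      calc _ ≤ (B * x) ^ r' := Real.rpow_le_rpow hlog0 hlog (by linarith)
        _ = B ^ r' * ((k : ℝ) + 1) ^ (r' / r) := by
          rw [Real.mul_rpow hB0.le (by linarith), hx, ← Real.rpow_mul (by positivity)]
          ring_nf
    unfold expExpLogPow at h1
    have h6 := Real.log_le_log (by positivity) h1
    rw [Real.log_exp, Real.log_pow] at h6
    push_cast at h6
    have h7 : (2 : ℝ) ^ k * Real.exp (-1) ≤ 2 ^ k * Real.log 2 := by
      gcongr
      linarith [Real.exp_neg_one_lt_d9, Real.log_two_gt_d9]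
    have h8 := Real.log_le_log (by positivity) (h7.trans h6)
    rw [Real.log_exp, Real.log_mul (by positivity) (by positivity), Real.log_exp,
      Real.log_pow] at h8
    push_cast at h5
    have h9 := mul_le_mul_of_nonneg_left h5 hC.le
    have h10 : (k : ℝ) * (1 / 2) ≤ k * Real.log 2 := by
      gcongr
      linarith [Real.log_two_gt_d9]
    rw [← mul_assoc C] at h9
    linarith
  have hexp : r' / r < 1 := (div_lt_one (by linarith)).2 hlt
  have hlim : Filter.Tendsto (fun k : ℕ => C * B ^ r' * ((k : ℝ) + 1) ^ (-(1 - r' / r)) +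
      2 * ((k : ℝ) + 1) ^ (-1 : ℝ)) Filter.atTop (nhds (C * B ^ r' * 0 + 2 * 0)) := by
    have ht : Filter.Tendsto (fun k : ℕ => (k : ℝ) + 1) Filter.atTop Filter.atTop :=
      Filter.tendsto_atTop_add_const_right _ _ tendsto_natCast_atTop_atTop
    exact (((tendsto_rpow_neg_atTop (sub_pos.2 hexp)).comp ht).const_mul _).add
      (((tendsto_rpow_neg_atTop one_pos).comp ht).const_mul _)
  have hev := hlim.eventually (gt_mem_nhds (show C * B ^ r' * 0 + 2 * 0 < 1 / 2 by norm_num))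
  obtain ⟨k, hk⟩ := hev.exists
  have hk0 : (0 : ℝ) < (k : ℝ) + 1 := by positivity
  have h1 := mul_lt_mul_of_pos_right hk hk0
  have e1 : ((k : ℝ) + 1) ^ (-(1 - r' / r)) * ((k : ℝ) + 1) = ((k : ℝ) + 1) ^ (r' / r) := by
    rw [← Real.rpow_add_one hk0.ne']
    ring_nf
  have e2 : ((k : ℝ) + 1) ^ (-1 : ℝ) * ((k : ℝ) + 1) = 1 := by
    rw [← Real.rpow_add_one hk0.ne']
    norm_num
  rw [add_mul, mul_assoc, e1, mul_assoc 2, e2] at h1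
  linarith [hmain k]

theorem mainTheorem5 :
    ∃ (Γ : Set.Ici (2 : ℝ) → Type) (_ : ∀ r, Group (Γ r)),
      -- each `Γ r` is a finitely generated LEF group
      (∀ r, Group.FG (Γ r) ∧ IsLEF (Γ r)) ∧
      -- the growth bounds that single out the group with parameter `r`
      (∀ r : Set.Ici (2 : ℝ), ∃ C : ℝ, 0 < C ∧ ∀ S : Finset (Γ r), Generates S →
        GrowthLE (fun n => (lefGrowth S n : ℝ)) (expExpLogPow C (r : ℝ))) ∧
      (∀ r : Set.Ici (2 : ℝ), ∀ r' : ℝ, 2 ≤ r' → r' < (r : ℝ) → ∀ C : ℝ, 0 < C →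
        ∀ S : Finset (Γ r), Generates S →
          ¬ GrowthLE (fun n => (lefGrowth S n : ℝ)) (expExpLogPow C r')) ∧
      -- the groups are pairwise nonisomorphic, with pairwise inequivalent LEF growth
      (∀ r₁ r₂ : Set.Ici (2 : ℝ), r₁ ≠ r₂ →
        IsEmpty (Γ r₁ ≃* Γ r₂) ∧
        ∀ (S : Finset (Γ r₁)) (T : Finset (Γ r₂)), Generates S → Generates T →
          ¬ GrowthEquiv (lefGrowth S) (lefGrowth T)) := by
  have hLEF : ∀ r : Set.Ici (2 : ℝ), IsLEF (layerGroup (pos r)) := fun r =>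
    isLEF_layerGroup_pos r.2
  have upper : ∀ r : Set.Ici (2 : ℝ), ∃ C : ℝ, 0 < C ∧ ∀ S : Finset (layerGroup (pos r)),
      Generates S → GrowthLE (fun n => (lefGrowth S n : ℝ)) (expExpLogPow C (r : ℝ)) := fun r =>
    ⟨6 * 2 ^ (r : ℝ) + 12, by positivity, fun S _ =>
      ((hLEF r).growthLE_lefGrowth S (generates_layerGens _)).natCast.trans
        (growthLE_expExpLogPow r.2)⟩
  have lower : ∀ r : Set.Ici (2 : ℝ), ∀ r' : ℝ, 2 ≤ r' → r' < (r : ℝ) → ∀ C : ℝ, 0 < C →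
      ∀ S : Finset (layerGroup (pos r)), Generates S →
        ¬ GrowthLE (fun n => (lefGrowth S n : ℝ)) (expExpLogPow C r') :=
    fun r r' hr' hlt C hC S hS h => not_growthLE_expExpLogPow r.2 hr' hlt hC
      (((hLEF r).growthLE_lefGrowth (layerGens (pos r)) hS).natCast.trans h)
  have not_le : ∀ r₁ r₂ : Set.Ici (2 : ℝ), (r₁ : ℝ) < r₂ → ∀ (S : Finset (layerGroup (pos r₁)))
      (T : Finset (layerGroup (pos r₂))), Generates S → Generates T →
        ¬ GrowthLE (lefGrowth T) (lefGrowth S) := by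
    intro r₁ r₂ hlt S T hS hT h
    -- The upper bound for `r₁` contradicts the lower bound for `r₂` taken at `r' = r₁`.
    obtain ⟨C, hC, hup⟩ := upper r₁
    exact lower r₂ r₁ r₁.2 hlt C hC T hT (h.natCast.trans (hup S hS))
  have not_equiv : ∀ r₁ r₂ : Set.Ici (2 : ℝ), r₁ ≠ r₂ → ∀ (S : Finset (layerGroup (pos r₁)))
      (T : Finset (layerGroup (pos r₂))), Generates S → Generates T →
        ¬ GrowthEquiv (lefGrowth S) (lefGrowth T) := by
    intro r₁ r₂ hne S T hS hT h
    rcases lt_or_gt_of_ne (Subtype.coe_ne_coe.2 hne) with hlt | hlt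
    · exact not_le r₁ r₂ hlt S T hS hT h.2
    · exact not_le r₂ r₁ hlt T S hT hS h.1
  refine ⟨fun r => layerGroup (pos r), fun r => inferInstance, fun r => ⟨fg_layerGroup _, hLEF r⟩,
    upper, lower, fun r₁ r₂ hne => ⟨⟨fun e => ?_⟩, not_equiv r₁ r₂ hne⟩⟩
  have hS := generates_layerGens (pos r₁)
  have hT := hS.map e
  refine not_equiv r₁ r₂ hne _ _ hS hT ⟨⟨1, one_pos, fun n => ?_⟩, ⟨1, one_pos, fun n => ?_⟩⟩
  · rw [one_mul]
    exact (hLEF r₂).lefGrowth_le_map e _ n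
  · rw [one_mul]
    refine ((hLEF r₁).lefGrowth_le_map e.symm _ n).trans_eq ?_
    congr 1
    ext x
    simp
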